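/- Consider a position auction with $k$ positions and $n>k$ agents. Let $\alpha,\beta\in\mathbb{R}^k$ have positive, non-increasing entries, and put $\alpha_j=\beta_j=0$ for $j>k$. The values $v_1,\dots,v_n$ of the agents are independent and identically distributed, with a distribution that has a density and support $[0,\bar v]$, $0<\bar v<\infty$, and whose cumulative distribution function has three derivatives that exist and are bounded on $(0,\bar v)$. Given a bid profile $b\in\mathbb{R}^n$, a fixed allocation rule $g$ assigns positions $1,\dots,n$ to the agents one-to-one in non-increasing order of their bids, breaking ties in an arbitrary fixed way (positions beyond $k$ are worthless). Write $b_{(j)}$ for the $j$-th largest bid. The $\alpha$-VCG mechanism and the $\alpha$-GFP mechanism both use $g$ and charge agent $i$, respectively, $$p^V_i(b)=\sum_{j=g_i(b)}^{k}(\alpha_j-\alpha_{j+1})\,b_{(j+1)}\qquad\text{and}\qquad p^F_i(b)=\alpha_{g_i(b)}\,b_i .$$ Agent $i$ with value $v_i$ has utility $\beta_{g_i(b)}v_i-p_i(b)$. A bidding function $\mathfrak b:\mathbb{R}\to\mathbb{R}$, used by all agents, is a Bayes-Nash equilibrium if, for every agent $i$ and every value $v_i\in[0,\bar v]$, the bid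 $\mathfrak b(v_i)$ maximizes over all bids $x\in\mathbb{R}$ the (well-defined) expected utility of agent $i$ when the other agents bid $\mathfrak b(v_j)$. The equilibrium yields the truthful VCG outcome if almost surely every agent is assigned the position $g_i(v)$ that it is assigned under truthful bidding, and if for every agent and every own value $v_i\in[0,\bar v]$ the expected payment given $v_i$ equals that in the $\beta$-VCG mechanism under truthful bidding. If the $\alpha$-VCG mechanism has a Bayes-Nash equilibrium that yields the truthful VCG outcome, then so does the $\alpha$-GFP mechanism. -/

import Mathlib

open MeasureTheory ProbabilityTheory

noncomputable section

namespace PositionAuction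

/-- Vectors of relative values of `k` positions: positive, non-increasing entries. -/
def IsPositionVector {k : ℕ} (β : Fin k → ℝ) : Prop :=
  (∀ j, 0 < β j) ∧ Antitone β

/-- The entry `β_j`, with positions numbered from `0` and the convention `β_j = 0` for `j ≥ k`. -/
def entry {k : ℕ} (β : Fin k → ℝ) (j : ℕ) : ℝ :=
  if h : j < k then β ⟨j, h⟩ else 0

/-- The `j`-th largest entry of `b`, counted from `0` and with multiplicity
(so the largest is `orderStat b 0`), with the convention that it is `0` for `j ≥ n`.
`Tuple.sort b` sorts `b` in ascending order. -/
def orderStat {n : ℕ} (b : Fin n → ℝ) (j : ℕ) : ℝ :=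
  if h : j < n then b (Tuple.sort b (Fin.rev ⟨j, h⟩)) else 0

/-- `g b i` is the position (numbered from `0`) of agent `i` under the bid profile `b`;
agents with `k ≤ g b i` receive nothing. -/
abbrev AllocationRule (n : ℕ) : Type := (Fin n → ℝ) → Equiv.Perm (Fin n)

/-- Positions are assigned in non-increasing order of the bids, with ties broken arbitrarily
(by a fixed rule, since `g` is a function). -/
def IsEfficientRule {n : ℕ} (g : AllocationRule n) : Prop :=
  ∀ (b : Fin n → ℝ) (i j : Fin n), b j < b i → g b i < g b j

/-- A mechanism: an allocation rule and a payment rule, `pay b i` being the payment of agent `i`. -/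
structure Mechanism (n : ℕ) where
  alloc : AllocationRule n
  pay : (Fin n → ℝ) → Fin n → ℝ

/-- The VCG mechanism with parameter `α`: the agent in position `s` pays
`∑_{j ≥ s} (α_j - α_{j+1}) b_{(j+1)}`, the sum being over positions `j`. -/
def vcg {n k : ℕ} (g : AllocationRule n) (α : Fin k → ℝ) : Mechanism n where
  alloc := g
  pay b i := ∑ j ∈ Finset.Ico (g b i : ℕ) k, (entry α j - entry α (j + 1)) * orderStat b (j + 1)

/-- The generalized first-price mechanism with parameter `α`: the agent in position `s` pays
`α_s` times its own bid. -/
def gfp {n k : ℕ} (g : AllocationRule n) (α : Fin k → ℝ) : Mechanism n where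
  alloc := g
  pay b i := entry α (g b i) * b i

/-- The utility of agent `i` with value `x`, when position `j` is worth `β_j x` to it. -/
def utility {n k : ℕ} (M : Mechanism n) (β : Fin k → ℝ) (i : Fin n) (b : Fin n → ℝ) (x : ℝ) : ℝ :=
  entry β (M.alloc b i) * x - M.pay b i

/-- The bid profile in which agent `i` bids `x` and every other agent `j` bids `b (w j)`. -/
def bidProfile {n : ℕ} (b : ℝ → ℝ) (i : Fin n) (x : ℝ) (w : Fin n → ℝ) : Fin n → ℝ :=
  Function.update (fun j => b (w j)) i x

/-- The joint law of `n` independent values with law `μ`. -/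
def valueLaw (n : ℕ) (μ : Measure ℝ) : Measure (Fin n → ℝ) :=
  Measure.pi fun _ => μ

/-- The expected utility of agent `i` with value `v` when it bids `x` and all other agents use the
bidding function `b`. The profile `bidProfile b i x w` does not depend on `w i`, so this is the
expectation over the values of the other agents. -/
def expectedUtility {n k : ℕ} (M : Mechanism n) (β : Fin k → ℝ) (μ : Measure ℝ) (b : ℝ → ℝ)
    (i : Fin n) (x v : ℝ) : ℝ :=
  ∫ w, utility M β i (bidProfile b i x w) v ∂valueLaw n μ

/-- The expected payment of agent `i` when it bids `x` and all other agents use the bidding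
function `b`. -/
def expectedPayment {n : ℕ} (M : Mechanism n) (μ : Measure ℝ) (b : ℝ → ℝ) (i : Fin n) (x : ℝ) : ℝ :=
  ∫ w, M.pay (bidProfile b i x w) i ∂valueLaw n μ

/-- The symmetric profile `(b, …, b)` is a Bayes-Nash equilibrium: expected utilities are
well defined, and for every agent and every value in `[0, vbar]` bidding according to `b` is
optimal among all bids. -/
structure IsBayesNash {n k : ℕ} (M : Mechanism n) (β : Fin k → ℝ) (μ : Measure ℝ) (vbar : ℝ)
    (b : ℝ → ℝ) : Prop where
  measurable : Measurable b
  integrable : ∀ (i : Fin n), ∀ v ∈ Set.Icc 0 vbar, ∀ x : ℝ,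
    Integrable (fun w => utility M β i (bidProfile b i x w) v) (valueLaw n μ)
  optimal : ∀ (i : Fin n), ∀ v ∈ Set.Icc 0 vbar, ∀ x : ℝ,
    expectedUtility M β μ b i x v ≤ expectedUtility M β μ b i (b v) v

/-- When all agents use `b`, the mechanism produces the truthful VCG outcome: almost surely the
positions are those that the VCG mechanism assigns for the true values, and every agent, given
its value, has the same expected payment as in the VCG mechanism (with the true parameter `β`)
under truthful bidding. -/
structure YieldsTruthfulVCG {n k : ℕ} (M : Mechanism n) (g : AllocationRule n) (β : Fin k → ℝ)
    (μ : Measure ℝ) (vbar : ℝ) (b : ℝ → ℝ) : Prop where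
  alloc_eq : ∀ᵐ w ∂valueLaw n μ, M.alloc (fun i => b (w i)) = (vcg g β).alloc w
  pay_eq : ∀ (i : Fin n), ∀ v ∈ Set.Icc 0 vbar,
    expectedPayment M μ b i (b v) = expectedPayment (vcg g β) μ id i v

/-- The mechanism obtains the truthful VCG outcome in a Bayes-Nash equilibrium. -/
def ObtainsTruthfulVCG {n k : ℕ} (M : Mechanism n) (g : AllocationRule n) (β : Fin k → ℝ)
    (μ : Measure ℝ) (vbar : ℝ) : Prop :=
  ∃ b : ℝ → ℝ, IsBayesNash M β μ vbar b ∧ YieldsTruthfulVCG M g β μ vbar b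

/-- The standing assumptions on the law `μ` of a value: it has a density and support `[0, vbar]`,
and the first three derivatives of its distribution function exist and are bounded in the interior
of the support. -/
structure IsValueDistribution (μ : Measure ℝ) (vbar : ℝ) : Prop where
  isProbabilityMeasure : IsProbabilityMeasure μ
  vbar_pos : 0 < vbar
  absolutelyContinuous : μ ≪ volume
  support_eq : μ.support = Set.Icc 0 vbar
  differentiable : ∀ m < 3, DifferentiableOn ℝ (iteratedDeriv m (fun t => cdf μ t)) (Set.Ioo 0 vbar)
  bounded : ∃ C : ℝ, ∀ m ≤ 3, ∀ t ∈ Set.Ioo 0 vbar, |iteratedDeriv m (fun t => cdf μ t) t| ≤ C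

end PositionAuction

end

open MeasureTheory ProbabilityTheory

noncomputable section

namespace PositionAuction

variable {n k : ℕ}

/-- The number of agents other than `i` whose entry in `w` exceeds `x`. -/
def rivalsAbove (i : Fin n) (w : Fin n → ℝ) (x : ℝ) : ℕ :=
  ((Finset.univ.erase i).filter fun m => x < w m).card

/-- The sum of `(γ_c - γ_{c+1}) φ(w_l)` over the agents `l ≠ i` with `w_l < v`, where `c` is the
number of agents other than `i` whose entry exceeds `w_l`. -/
def rivalSum (γ : Fin k → ℝ) (φ : ℝ → ℝ) (i : Fin n) (v : ℝ) (w : Fin n → ℝ) : ℝ :=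
  ∑ l ∈ Finset.univ.erase i, if w l < v then
    (entry γ (rivalsAbove i w (w l)) - entry γ (rivalsAbove i w (w l) + 1)) * φ (w l) else 0

lemma entry_eq_zero (γ : Fin k → ℝ) {j : ℕ} (h : k ≤ j) : entry γ j = 0 := by
  simp [entry, h.not_gt]

lemma entry_nonneg {γ : Fin k → ℝ} (hγ : IsPositionVector γ) (j : ℕ) : 0 ≤ entry γ j := by
  unfold entry
  split_ifs with h
  · exact (hγ.1 _).le
  · exact le_rfl

lemma entry_succ_le {γ : Fin k → ℝ} (hγ : IsPositionVector γ) (j : ℕ) :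
    entry γ (j + 1) ≤ entry γ j := by
  by_cases h : j + 1 < k
  · have h' : j < k := by omega
    simp only [entry, h, h', dif_pos]
    exact hγ.2 (Fin.mk_le_mk.2 (Nat.le_succ j))
  · rw [entry_eq_zero γ (not_lt.1 h)]
    exact entry_nonneg hγ j

lemma entry_zero_pos {γ : Fin k → ℝ} (hγ : IsPositionVector γ) (hk : 0 < k) : 0 < entry γ 0 := by
  simp only [entry, hk, dif_pos]
  exact hγ.1 _

lemma abs_entry_le (γ : Fin k → ℝ) (j : ℕ) : |entry γ j| ≤ ∑ i, |γ i| := by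
  unfold entry
  split_ifs with h
  · exact Finset.single_le_sum (f := fun i => |γ i|) (fun i _ => abs_nonneg _) (Finset.mem_univ _)
  · simpa using Finset.sum_nonneg fun i _ => abs_nonneg (γ i)

lemma rivalsAbove_update (i : Fin n) (w : Fin n → ℝ) (v x : ℝ) :
    rivalsAbove i (Function.update w i v) x = rivalsAbove i w x := by
  unfold rivalsAbove
  congr 1
  refine Finset.filter_congr fun m hm => ?_
  rw [Function.update_of_ne (Finset.ne_of_mem_erase hm)]

lemma rivalSum_update (γ : Fin k → ℝ) (φ : ℝ → ℝ) (i : Fin n) (v x : ℝ) (w : Fin n → ℝ) :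
    rivalSum γ φ i v (Function.update w i x) = rivalSum γ φ i v w := by
  unfold rivalSum
  refine Finset.sum_congr rfl fun l hl => ?_
  rw [Function.update_of_ne (Finset.ne_of_mem_erase hl), rivalsAbove_update]

/-- An agent whose bid is tied with no other is placed after exactly those who bid more. -/
lemma IsEfficientRule.position_eq {g : AllocationRule n} (hg : IsEfficientRule g)
    (p : Fin n → ℝ) (i : Fin n) (h : ∀ m, m ≠ i → p m ≠ p i) :
    (g p i : ℕ) = rivalsAbove i p (p i) := by
  have h1 : ((Finset.univ.erase i).filter fun m => p i < p m) =
      Finset.univ.filter fun m => g p m < g p i := by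
    ext m
    simp only [Finset.mem_filter, Finset.mem_erase, Finset.mem_univ, and_true, true_and]
    constructor
    · exact fun hm => hg p m i hm.2
    · intro hm
      have hne : m ≠ i := by rintro rfl; exact lt_irrefl _ hm
      refine ⟨hne, lt_of_le_of_ne (not_lt.1 fun hlt => ?_) (h m hne).symm⟩
      exact lt_asymm hm (hg p i m hlt)
  unfold rivalsAbove
  rw [h1, ← Fin.card_Iio (g p i), ← Finset.card_map (g p).symm.toEmbedding]
  congr 1
  ext m
  simp

/-- Listing the entries of an injective tuple in decreasing order. -/
lemma exists_decreasing_enumeration (p : Fin n → ℝ) (hp : Function.Injective p) :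
    ∃ e : Equiv.Perm (Fin n), (∀ j j', p (e j) < p (e j') ↔ j' < j) ∧
      ∀ j : Fin n, orderStat p j = p (e j) := by
  refine ⟨Fin.revPerm.trans (Tuple.sort p), fun j j' => ?_, fun j => ?_⟩
  · have hs : StrictMono (p ∘ Tuple.sort p) :=
      (Tuple.monotone_sort p).strictMono_of_injective (hp.comp (Tuple.sort p).injective)
    simpa using hs.lt_iff_lt (a := Fin.rev j) (b := Fin.rev j')
  · simp [orderStat]

/-- Summation over the positions below that of agent `i`, as a sum over agents. -/
lemma sum_positions_below (p : Fin n → ℝ) (hp : Function.Injective p) (i : Fin n)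
    (ψ : ℕ → ℝ → ℝ) :
    ∑ j ∈ Finset.Ico (rivalsAbove i p (p i)) (n - 1), ψ j (orderStat p (j + 1)) =
      ∑ l ∈ Finset.univ.erase i,
        if p l < p i then ψ (rivalsAbove i p (p l)) (p l) else 0 := by
  obtain ⟨e, he, hstat⟩ := exists_decreasing_enumeration p hp
  obtain ⟨s, rfl⟩ := e.surjective i
  have hcount : ∀ j, rivalsAbove (e s) p (p (e j)) =
      ((Finset.univ.erase s).filter fun m => m < j).card := by
    intro j
    unfold rivalsAbove
    rw [← Finset.card_map (s := (Finset.univ.erase s).filter fun m => m < j) e.toEmbedding]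
    congr 1
    ext m
    obtain ⟨m, rfl⟩ := e.surjective m
    simp [he]
  have hs : rivalsAbove (e s) p (p (e s)) = s := by
    rw [hcount, ← Fin.card_Iio s]
    congr 1
    ext m
    simp only [Finset.mem_filter, Finset.mem_erase, Finset.mem_univ, and_true, Finset.mem_Iio]
    exact ⟨fun h => h.2, fun h => ⟨h.ne, h⟩⟩
  have hlow : ∀ j, s < j → rivalsAbove (e s) p (p (e j)) = (j : ℕ) - 1 := by
    intro j hj
    rw [hcount, ← Fin.card_Iio j, ← Finset.card_erase_of_mem (Finset.mem_Iio.2 hj)]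
    congr 1
    ext m
    simp
  rw [hs, ← Finset.sum_filter]
  refine Finset.sum_bij' (fun j hj => e ⟨j + 1, by simp at hj; omega⟩)
    (fun l _ => (e.symm l : ℕ) - 1) ?_ ?_ ?_ ?_ ?_
  · intro j hj
    simp only [Finset.mem_Ico] at hj
    simp only [Finset.mem_filter, Finset.mem_erase, Finset.mem_univ, and_true, he, ne_eq,
      EmbeddingLike.apply_eq_iff_eq, Fin.ext_iff, Fin.lt_def]
    omega
  · intro l hl
    obtain ⟨l, rfl⟩ := e.surjective l
    simp only [Finset.mem_filter, he, Fin.lt_def] at hl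
    simp only [Equiv.symm_apply_apply, Finset.mem_Ico]
    omega
  · intro j hj
    simp
  · intro l hl
    obtain ⟨l, rfl⟩ := e.surjective l
    simp only [Finset.mem_filter, he, Fin.lt_def] at hl
    simp only [Equiv.symm_apply_apply, EmbeddingLike.apply_eq_iff_eq, Fin.ext_iff]
    omega
  · intro j hj
    simp only [Finset.mem_Ico] at hj
    have hj' : j + 1 < n := by omega
    rw [hlow ⟨j + 1, hj'⟩ (by simp [Fin.lt_def]; omega), ← hstat]
    simp

lemma vcg_pay_eq {g : AllocationRule n} (hg : IsEfficientRule g) (hkn : k < n) (γ : Fin k → ℝ)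
    (p : Fin n → ℝ) (hp : Function.Injective p) (i : Fin n) :
    (vcg g γ).pay p i = rivalSum γ id i (p i) p := by
  have h := sum_positions_below p hp i fun j x => (entry γ j - entry γ (j + 1)) * x
  simp only [rivalSum, id, ← h, vcg]
  rw [hg.position_eq p i fun m hm => hp.ne hm]
  refine Finset.sum_subset (Finset.Ico_subset_Ico_right (by omega)) fun j hj hj' => ?_
  simp only [Finset.mem_Ico] at hj hj'
  rw [entry_eq_zero γ (j := j) (by omega), entry_eq_zero γ (j := j + 1) (by omega)]
  simp

lemma rivalsAbove_lt (i : Fin n) (w : Fin n → ℝ) (x : ℝ) : rivalsAbove i w x < n := by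
  refine lt_of_le_of_lt (Finset.card_filter_le _ _) ?_
  rw [Finset.card_erase_of_mem (Finset.mem_univ i), Finset.card_univ, Fintype.card_fin]
  exact Nat.sub_lt i.pos one_pos

lemma entry_rivalsAbove_eq (hkn : k < n) (γ : Fin k → ℝ) (p : Fin n → ℝ)
    (hp : Function.Injective p) (i : Fin n) :
    entry γ (rivalsAbove i p (p i)) = rivalSum γ 1 i (p i) p := by
  have h := sum_positions_below p hp i fun j _ => (entry γ j - entry γ (j + 1)) * 1
  have hlt := rivalsAbove_lt i p (p i)
  simp only [rivalSum, Pi.one_apply, ← h]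
  simp only [mul_one]
  rw [Finset.sum_Ico_eq_sub _ (by omega), Finset.sum_range_sub', Finset.sum_range_sub',
    entry_eq_zero γ (j := n - 1) (by omega)]
  ring

/-- Permuting the agents permutes the sums. -/
lemma rivalSum_comp_perm (γ : Fin k → ℝ) (φ : ℝ → ℝ) (σ : Equiv.Perm (Fin n)) (i : Fin n) (v : ℝ)
    (w : Fin n → ℝ) : rivalSum γ φ i v (w ∘ σ) = rivalSum γ φ (σ i) v w := by
  have hcount : ∀ x, rivalsAbove i (w ∘ σ) x = rivalsAbove (σ i) w x := by
    intro x
    unfold rivalsAbove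
    rw [← Finset.card_map (s := (Finset.univ.erase i).filter fun m => x < (w ∘ σ) m) σ.toEmbedding]
    congr 1
    ext m
    obtain ⟨m, rfl⟩ := σ.surjective m
    simp
  unfold rivalSum
  refine Finset.sum_bij (fun l _ => σ l) ?_ ?_ ?_ ?_
  · intro l hl
    simpa using hl
  · intro l _ l' _ h
    exact σ.injective h
  · intro l hl
    obtain ⟨l, rfl⟩ := σ.surjective l
    exact ⟨l, by simpa using hl, rfl⟩
  · intro l _
    simp only [hcount, Function.comp_apply]

lemma rivalSum_nonneg {γ : Fin k → ℝ} (hγ : IsPositionVector γ) {φ : ℝ → ℝ} {i : Fin n} {v : ℝ}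
    {w : Fin n → ℝ} (h : ∀ l, l ≠ i → w l < v → 0 ≤ φ (w l)) : 0 ≤ rivalSum γ φ i v w := by
  refine Finset.sum_nonneg fun l hl => ?_
  split_ifs with hlv
  · exact mul_nonneg (sub_nonneg.2 (entry_succ_le hγ _)) (h l (Finset.ne_of_mem_erase hl) hlv)
  · exact le_rfl

lemma rivalSum_const_sub (γ : Fin k → ℝ) (φ : ℝ → ℝ) (c : ℝ) (i : Fin n) (v : ℝ)
    (w : Fin n → ℝ) :
    rivalSum γ (fun t => c - φ t) i v w = c * rivalSum γ 1 i v w - rivalSum γ φ i v w := by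
  simp only [rivalSum, Finset.mul_sum, ← Finset.sum_sub_distrib]
  refine Finset.sum_congr rfl fun l _ => ?_
  split_ifs
  · simp only [Pi.one_apply]; ring
  · simp

lemma rivalSum_le_rivalSum {γ : Fin k → ℝ} (hγ : IsPositionVector γ) {φ : ℝ → ℝ} {i : Fin n}
    {u v : ℝ} {w : Fin n → ℝ} (h1 : ∀ l, l ≠ i → u ≤ w l → w l < v → 0 ≤ φ (w l))
    (h2 : ∀ l, l ≠ i → v ≤ w l → w l < u → φ (w l) ≤ 0) :
    rivalSum γ φ i u w ≤ rivalSum γ φ i v w := by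
  refine Finset.sum_le_sum fun l hl => ?_
  have hne := Finset.ne_of_mem_erase hl
  have h0 := sub_nonneg.2 (entry_succ_le hγ (rivalsAbove i w (w l)))
  split_ifs with h h' h'
  · exact le_rfl
  · exact mul_nonpos_of_nonneg_of_nonpos h0 (h2 l hne (not_lt.1 h') h)
  · exact mul_nonneg h0 (h1 l hne (not_lt.1 h) h')
  · exact le_rfl

/-- If every rival is below `v`, the weights add up to `γ_0`. -/
lemma rivalSum_pos (hkn : k < n) {γ : Fin k → ℝ} (hγ : IsPositionVector γ) (hk : 0 < k)
    {φ : ℝ → ℝ} {i : Fin n} {v : ℝ} {w : Fin n → ℝ}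
    (hw : Function.Injective (Function.update w i v)) (hlt : ∀ l, l ≠ i → w l < v)
    (h : ∀ l, l ≠ i → 0 < φ (w l)) : 0 < rivalSum γ φ i v w := by
  have h1 := entry_rivalsAbove_eq hkn γ _ hw i
  rw [Function.update_self, rivalsAbove_update, rivalSum_update] at h1
  have h2 : rivalsAbove i w v = 0 := by
    refine Finset.card_eq_zero.2 (Finset.filter_eq_empty_iff.2 fun m hm => ?_)
    exact (hlt m (Finset.ne_of_mem_erase hm)).not_gt
  have h3 : 0 < rivalSum γ 1 i v w := by
    rw [← h1, h2]
    exact entry_zero_pos hγ hk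
  obtain ⟨l, hl, hpos⟩ := Finset.exists_lt_of_sum_lt
    (lt_of_eq_of_lt (Finset.sum_const_zero (s := Finset.univ.erase i)) h3)
  have hne := Finset.ne_of_mem_erase hl
  simp only [hlt l hne, if_true, Pi.one_apply, mul_one] at hpos
  refine Finset.sum_pos' (fun l' hl' => ?_) ⟨l, hl, ?_⟩
  · have hne' := Finset.ne_of_mem_erase hl'
    rw [if_pos (hlt l' hne')]
    exact mul_nonneg (sub_nonneg.2 (entry_succ_le hγ _)) (h l' hne').le
  · rw [if_pos (hlt l hne)]
    exact mul_pos hpos (h l hne)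

section ValueLaw

variable {μ : Measure ℝ} [IsProbabilityMeasure μ]

instance : IsProbabilityMeasure (valueLaw n μ) := by
  unfold valueLaw
  infer_instance

lemma ae_valueLaw_of_ae {P : ℝ → Prop} (h : ∀ᵐ t ∂μ, P t) :
    ∀ᵐ w ∂valueLaw n μ, ∀ l, P (w l) :=
  Filter.eventually_all.2 fun _ => Measure.tendsto_eval_ae_ae.eventually h

lemma measurePreserving_comp_perm (σ : Equiv.Perm (Fin n)) :
    MeasurePreserving (fun w : Fin n → ℝ => w ∘ σ) (valueLaw n μ) (valueLaw n μ) := by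
  unfold valueLaw
  convert measurePreserving_piCongrLeft (fun _ : Fin n => μ) σ.symm using 1
  ext w j
  obtain ⟨j, rfl⟩ := σ.symm.surjective j
  rw [MeasurableEquiv.coe_piCongrLeft, Equiv.piCongrLeft_apply_apply]
  simp

/-- Replacing the value of one agent by an independent copy preserves the law. -/
lemma measurePreserving_update (i : Fin n) :
    MeasurePreserving (fun q : ℝ × (Fin n → ℝ) => Function.update q.2 i q.1)
      (μ.prod (valueLaw n μ)) (valueLaw n μ) := by
  have hm : Measurable fun q : ℝ × (Fin n → ℝ) => Function.update q.2 i q.1 := by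
    refine measurable_pi_iff.2 fun j => ?_
    by_cases h : j = i
    · subst h
      simpa using measurable_fst
    · simp only [Function.update_of_ne h]
      exact (measurable_pi_apply j).comp measurable_snd
  refine ⟨hm, (Measure.pi_eq fun s hs => ?_).symm⟩
  rw [Measure.map_apply hm (MeasurableSet.univ_pi hs)]
  have hpre : (fun q : ℝ × (Fin n → ℝ) => Function.update q.2 i q.1) ⁻¹' Set.univ.pi s =
      s i ×ˢ Set.univ.pi (Function.update s i Set.univ) := by
    ext q
    simp only [Set.mem_preimage, Set.mem_univ_pi, Set.mem_prod]
    constructor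
    · refine fun h => ⟨by simpa using h i, fun j => ?_⟩
      by_cases hj : j = i
      · subst hj; simp
      · simpa [Function.update_of_ne hj] using h j
    · rintro ⟨h1, h2⟩ j
      by_cases hj : j = i
      · subst hj; simpa using h1
      · simpa [Function.update_of_ne hj] using h2 j
  rw [hpre, Measure.prod_prod, valueLaw, Measure.pi_pi,
    ← Finset.mul_prod_erase _ _ (Finset.mem_univ i),
    ← Finset.mul_prod_erase Finset.univ (fun j => μ (s j)) (Finset.mem_univ i)]
  simp only [Function.update_self, measure_univ, one_mul]
  congr 1
  refine Finset.prod_congr rfl fun j hj => ?_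
  rw [Function.update_of_ne (Finset.ne_of_mem_erase hj)]

lemma ae_ae_update {P : (Fin n → ℝ) → Prop} (h : ∀ᵐ w ∂valueLaw n μ, P w) (i : Fin n) :
    ∀ᵐ v ∂μ, ∀ᵐ w ∂valueLaw n μ, P (Function.update w i v) :=
  Measure.ae_ae_of_ae_prod ((measurePreserving_update i).quasiMeasurePreserving.ae h)

/-- Independent values with a common law are almost surely separated by a function all of whose
fibres are null sets. -/
lemma ae_injective_comp {f : ℝ → ℝ} (hf : Measurable f) (h0 : ∀ c, μ (f ⁻¹' {c}) = 0) :
    ∀ᵐ w ∂valueLaw n μ, Function.Injective fun l => f (w l) := by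
  have key : ∀ l m : Fin n, l ≠ m → ∀ᵐ w ∂valueLaw n μ, f (w l) ≠ f (w m) := by
    intro l m hlm
    have hfl : ∀ l : Fin n, Measurable fun w : Fin n → ℝ => f (w l) := fun l =>
      hf.comp (measurable_pi_apply l)
    have hind : IndepFun (fun w : Fin n → ℝ => f (w l)) (fun w => f (w m)) (valueLaw n μ) :=
      (iIndepFun_pi (μ := fun _ : Fin n => μ) (X := fun _ => f)
        fun _ => hf.aemeasurable).indepFun hlm
    rw [indepFun_iff_map_prod_eq_prod_map_map (hfl l).aemeasurable (hfl m).aemeasurable] at hind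
    have hmap : ∀ m : Fin n, (valueLaw n μ).map (fun w => f (w m)) = μ.map f := fun m => by
      conv_rhs => rw [← (measurePreserving_eval (fun _ : Fin n => μ) m).map_eq]
      exact (Measure.map_map hf (measurable_pi_apply m)).symm
    have hd : MeasurableSet {q : ℝ × ℝ | q.1 = q.2} :=
      measurableSet_eq_fun measurable_fst measurable_snd
    have hz : ((μ.map f).prod (μ.map f)) {q : ℝ × ℝ | q.1 = q.2} = 0 := by
      have := Measure.isProbabilityMeasure_map (μ := μ) hf.aemeasurable
      refine (Measure.measure_prod_null hd).2 (Filter.Eventually.of_forall fun c => ?_)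
      have : Prod.mk c ⁻¹' {q : ℝ × ℝ | q.1 = q.2} = {c} := by
        ext x; simp [eq_comm]
      simp only [this, Measure.map_apply hf (measurableSet_singleton c)]
      simpa using h0 c
    rw [hmap, hmap] at hind
    rw [← hind, Measure.map_apply ((hfl l).prodMk (hfl m)) hd] at hz
    exact measure_eq_zero_iff_ae_notMem.1 hz
  have hall : ∀ᵐ w ∂valueLaw n μ, ∀ l m : Fin n, l ≠ m → f (w l) ≠ f (w m) :=
    Filter.eventually_all.2 fun l => Filter.eventually_all.2 fun m => by
      by_cases h : l = m
      · simp [h]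
      · filter_upwards [key l m h] with w hw _ using hw
  filter_upwards [hall] with w hw l m hlm
  by_contra hne
  exact hw l m hne hlm

lemma measurable_rivalsAbove (i : Fin n) {f : (Fin n → ℝ) → ℝ} (hf : Measurable f) :
    Measurable fun w : Fin n → ℝ => rivalsAbove i w (f w) := by
  unfold rivalsAbove
  simp only [Finset.card_filter]
  exact Finset.measurable_sum _ fun m _ =>
    Measurable.ite (measurableSet_lt hf (measurable_pi_apply m)) measurable_const measurable_const

lemma measurable_rivalSum (γ : Fin k → ℝ) {φ : ℝ → ℝ} (hφ : Measurable φ) (i : Fin n) (v : ℝ) :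
    Measurable (rivalSum γ φ i v) := by
  unfold rivalSum
  refine Finset.measurable_sum _ fun l _ => Measurable.ite
    (measurableSet_lt (measurable_pi_apply l) measurable_const) ?_ measurable_const
  have hc := measurable_rivalsAbove i (measurable_pi_apply (X := fun _ : Fin n => ℝ) l)
  have h1 : Measurable fun j : ℕ => entry γ j - entry γ (j + 1) := measurable_from_top
  exact (h1.comp hc).mul (hφ.comp (measurable_pi_apply l))

lemma abs_rivalSum_le (γ : Fin k → ℝ) {φ : ℝ → ℝ} {C : ℝ} {i : Fin n} (v : ℝ) {w : Fin n → ℝ}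
    (h : ∀ l, |φ (w l)| ≤ C) : |rivalSum γ φ i v w| ≤ n * (2 * (∑ j, |γ j|) * C) := by
  have hS : 0 ≤ ∑ j, |γ j| := Finset.sum_nonneg fun j _ => abs_nonneg _
  have hC : 0 ≤ C := (abs_nonneg _).trans (h i)
  have hterm : ∀ l ∈ Finset.univ.erase i, |if w l < v then
      (entry γ (rivalsAbove i w (w l)) - entry γ (rivalsAbove i w (w l) + 1)) * φ (w l) else 0| ≤
      2 * (∑ j, |γ j|) * C := by
    intro l _
    split_ifs
    · rw [abs_mul]
      refine mul_le_mul ?_ (h l) (abs_nonneg _) (by positivity)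
      refine (abs_sub _ _).trans ?_
      linarith [abs_entry_le γ (rivalsAbove i w (w l)), abs_entry_le γ (rivalsAbove i w (w l) + 1)]
    · rw [abs_zero]; positivity
  refine (Finset.abs_sum_le_sum_abs _ _).trans ((Finset.sum_le_card_nsmul _ _ _ hterm).trans ?_)
  rw [nsmul_eq_mul]
  refine mul_le_mul_of_nonneg_right ?_ (by positivity)
  exact_mod_cast (Finset.card_le_univ _).trans (Fintype.card_fin n).le

lemma integrable_rivalSum (γ : Fin k → ℝ) {φ : ℝ → ℝ} (hφ : Measurable φ) {C : ℝ}
    (hC : ∀ᵐ t ∂μ, |φ t| ≤ C) (i : Fin n) (v : ℝ) :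
    Integrable (rivalSum γ φ i v) (valueLaw n μ) := by
  refine Integrable.of_bound (measurable_rivalSum γ hφ i v).aestronglyMeasurable
    (n * (2 * (∑ j, |γ j|) * C)) ?_
  filter_upwards [ae_valueLaw_of_ae hC] with w hw using abs_rivalSum_le γ v hw

lemma integrable_rivalSum_one (γ : Fin k → ℝ) (i : Fin n) (v : ℝ) :
    Integrable (rivalSum γ 1 i v) (valueLaw n μ) :=
  integrable_rivalSum γ measurable_one (C := 1) (by simp) i v

lemma integral_rivalSum_eq (γ : Fin k → ℝ) {φ : ℝ → ℝ} (hφ : Measurable φ) (i i' : Fin n)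
    (v : ℝ) :
    ∫ w, rivalSum γ φ i v w ∂valueLaw n μ = ∫ w, rivalSum γ φ i' v w ∂valueLaw n μ := by
  have hmp := measurePreserving_comp_perm (μ := μ) (Equiv.swap i i')
  rw [← hmp.map_eq, integral_map hmp.measurable.aemeasurable
    (measurable_rivalSum γ hφ i v).aestronglyMeasurable, hmp.map_eq]
  simp only [rivalSum_comp_perm, Equiv.swap_apply_left]

lemma continuous_integral_rivalSum (hμ0 : ∀ t, μ {t} = 0) (γ : Fin k → ℝ) {φ : ℝ → ℝ}
    (hφ : Measurable φ) {C : ℝ} (hC : ∀ᵐ t ∂μ, |φ t| ≤ C) (i : Fin n) :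
    Continuous fun v => ∫ w, rivalSum γ φ i v w ∂valueLaw n μ := by
  refine continuous_iff_continuousAt.2 fun v => continuousAt_of_dominated
    (bound := fun _ => n * (2 * (∑ j, |γ j|) * C))
    (Filter.Eventually.of_forall fun x => (measurable_rivalSum γ hφ i x).aestronglyMeasurable)
    (Filter.Eventually.of_forall fun x => ?_) (integrable_const _) ?_
  · filter_upwards [ae_valueLaw_of_ae hC] with w hw using abs_rivalSum_le γ x hw
  · have hne : ∀ᵐ t ∂μ, t ≠ v := measure_eq_zero_iff_ae_notMem.1 (hμ0 v)
    filter_upwards [ae_valueLaw_of_ae hne] with w hw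
    unfold rivalSum
    refine tendsto_finsetSum _ fun l _ => ?_
    rcases lt_or_gt_of_ne (hw l) with h | h
    · refine tendsto_const_nhds.congr' ?_
      filter_upwards [lt_mem_nhds h] with x hx
      rw [if_pos h, if_pos hx]
    · refine tendsto_const_nhds.congr' ?_
      filter_upwards [gt_mem_nhds h] with x hx
      rw [if_neg h.not_gt, if_neg hx.not_gt]

lemma ae_injective_update (hμ0 : ∀ t, μ {t} = 0) (i : Fin n) (v : ℝ) :
    ∀ᵐ w ∂valueLaw n μ, Function.Injective (Function.update w i v) := by
  have hne : ∀ᵐ t ∂μ, t ≠ v := measure_eq_zero_iff_ae_notMem.1 (hμ0 v)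
  filter_upwards [ae_valueLaw_of_ae hne,
    ae_injective_comp (n := n) measurable_id fun c => hμ0 c] with w hw hinj l m hlm
  by_cases hl : l = i <;> by_cases hm : m = i
  · rw [hl, hm]
  · subst hl
    rw [Function.update_self, Function.update_of_ne hm] at hlm
    exact absurd hlm.symm (hw m)
  · subst hm
    rw [Function.update_self, Function.update_of_ne hl] at hlm
    exact absurd hlm (hw l)
  · rw [Function.update_of_ne hl, Function.update_of_ne hm] at hlm
    exact hinj hlm

lemma integral_rivalSum_pos (hμ0 : ∀ t, μ {t} = 0) (hkn : k < n) {γ : Fin k → ℝ}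
    (hγ : IsPositionVector γ) (hk : 0 < k) {φ : ℝ → ℝ} (i : Fin n) {v : ℝ} (hv : 0 < μ (Set.Iio v))
    (hint : Integrable (rivalSum γ φ i v) (valueLaw n μ))
    (hpos : ∀ᵐ w ∂valueLaw n μ, ∀ l, l ≠ i → w l < v → 0 < φ (w l)) :
    0 < ∫ w, rivalSum γ φ i v w ∂valueLaw n μ := by
  rw [integral_pos_iff_support_of_nonneg_ae _ hint]
  · have hbox : 0 < valueLaw n μ (Set.univ.pi fun _ => Set.Iio v) := by
      rw [valueLaw, Measure.pi_pi]
      exact pos_iff_ne_zero.2 (Finset.prod_ne_zero_iff.2 fun _ _ => hv.ne')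
    refine hbox.trans_le (measure_mono_ae ?_)
    filter_upwards [hpos, ae_injective_update hμ0 i v] with w hw hinj hmem
    have hlt : ∀ l, w l < v := fun l => hmem l (Set.mem_univ l)
    exact (rivalSum_pos hkn hγ hk hinj (fun l _ => hlt l) fun l hl => hw l hl (hlt l)).ne'
  · filter_upwards [hpos] with w hw using rivalSum_nonneg hγ fun l hl h => (hw l hl h).le

lemma ae_entry_rivalsAbove_eq (hμ0 : ∀ t, μ {t} = 0) (hkn : k < n) (γ : Fin k → ℝ) (i : Fin n)
    (v : ℝ) : ∀ᵐ w ∂valueLaw n μ, entry γ (rivalsAbove i w v) = rivalSum γ 1 i v w := by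
  filter_upwards [ae_injective_update hμ0 i v] with w hw
  have h := entry_rivalsAbove_eq hkn γ _ hw i
  rwa [Function.update_self, rivalsAbove_update, rivalSum_update] at h

lemma expectedPayment_truthful (hμ0 : ∀ t, μ {t} = 0) {g : AllocationRule n}
    (hg : IsEfficientRule g) (hkn : k < n) (γ : Fin k → ℝ) (i : Fin n) (v : ℝ) :
    expectedPayment (vcg g γ) μ id i v = ∫ w, rivalSum γ id i v w ∂valueLaw n μ := by
  refine integral_congr_ae ?_
  filter_upwards [ae_injective_update hμ0 i v] with w hw
  have h := vcg_pay_eq hg hkn γ _ hw i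
  rwa [Function.update_self, rivalSum_update] at h

/-- If the positions are almost surely the truthful ones, no bid is submitted with positive
probability. -/
lemma measure_fibre_eq_zero (hμ0 : ∀ t, μ {t} = 0) (hn : 2 ≤ n) {g : AllocationRule n}
    (hg : IsEfficientRule g) {b : ℝ → ℝ}
    (halloc : ∀ᵐ w ∂valueLaw n μ, g (fun i => b (w i)) = g w) (c : ℝ) : μ (b ⁻¹' {c}) = 0 := by
  let S : Set (Fin n → ℝ) := Set.univ.pi fun _ => b ⁻¹' {c}
  let i := (g fun _ => c).symm ⟨0, by omega⟩
  let j := (g fun _ => c).symm ⟨1, by omega⟩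
  have hij : i ≠ j := (g fun _ => c).symm.injective.ne (by simp [Fin.ext_iff])
  have h1 : ∀ᵐ w ∂valueLaw n μ, w ∈ S → w j < w i := by
    filter_upwards [halloc, ae_injective_comp (n := n) measurable_id fun c => hμ0 c]
      with w hw hinj hmem
    have hc : (fun i => b (w i)) = fun _ => c := funext fun l => hmem l (Set.mem_univ l)
    rw [hc] at hw
    by_contra hlt
    have hlt' : w i < w j := lt_of_le_of_ne (not_lt.1 hlt) (hinj.ne hij)
    have := hg w j i hlt'
    rw [← hw] at this
    simp [i, j, Fin.lt_def] at this
  have h2 : ∀ᵐ w ∂valueLaw n μ, w ∘ Equiv.swap i j ∈ S → w i < w j := by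
    filter_upwards [(measurePreserving_comp_perm (Equiv.swap i j)).quasiMeasurePreserving.ae h1]
      with w hw
    simpa using hw
  have h3 : ∀ᵐ w ∂valueLaw n μ, w ∉ S := by
    filter_upwards [h1, h2] with w hw1 hw2 hmem
    exact lt_asymm (hw1 hmem) (hw2 fun l _ => hmem (Equiv.swap i j l) (Set.mem_univ _))
  have h4 := measure_eq_zero_iff_ae_notMem.2 h3
  rw [valueLaw, Measure.pi_pi, Finset.prod_const] at h4
  exact eq_zero_of_pow_eq_zero h4

lemma ae_bid_lt_bid (hμ0 : ∀ t, μ {t} = 0) (hn : 2 ≤ n) {g : AllocationRule n}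
    (hg : IsEfficientRule g) {b : ℝ → ℝ} (hb : Measurable b)
    (halloc : ∀ᵐ w ∂valueLaw n μ, g (fun i => b (w i)) = g w) :
    ∀ᵐ w ∂valueLaw n μ, ∀ l m, w l < w m → b (w l) < b (w m) := by
  filter_upwards [halloc,
    ae_injective_comp (n := n) hb (measure_fibre_eq_zero hμ0 hn hg halloc)] with w hw hinj l m h
  have hne : l ≠ m := by rintro rfl; exact lt_irrefl _ h
  refine lt_of_le_of_ne (not_lt.1 fun hlt => ?_) (hinj.ne hne)
  have h1 := hg w m l h
  have h2 := hg (fun i => b (w i)) l m hlt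
  rw [hw] at h2
  exact lt_asymm h1 h2

end ValueLaw

lemma bidProfile_self (b : ℝ → ℝ) (i : Fin n) (x : ℝ) (w : Fin n → ℝ) :
    bidProfile b i x w i = x :=
  Function.update_self ..

lemma bidProfile_apply_eq (b : ℝ → ℝ) (i : Fin n) (v : ℝ) (w : Fin n → ℝ) :
    bidProfile b i (b v) w = fun j => b (Function.update w i v j) := by
  ext j
  by_cases h : j = i
  · subst h; simp [bidProfile]
  · simp [bidProfile, Function.update_of_ne h]

lemma rivalsAbove_comp {b : ℝ → ℝ} {u : Fin n → ℝ} (hb : ∀ l m, b (u l) < b (u m) ↔ u l < u m)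
    (i l : Fin n) : rivalsAbove i (fun j => b (u j)) (b (u l)) = rivalsAbove i u (u l) := by
  simp only [rivalsAbove, hb]

lemma rivalSum_comp {b : ℝ → ℝ} {u : Fin n → ℝ} (hb : ∀ l m, b (u l) < b (u m) ↔ u l < u m)
    (γ : Fin k → ℝ) (i : Fin n) :
    rivalSum γ id i (b (u i)) (fun j => b (u j)) = rivalSum γ b i (u i) u := by
  simp only [rivalSum, rivalsAbove_comp hb, hb, id]

lemma lt_iff_lt_of_injective {b : ℝ → ℝ} {u : Fin n → ℝ} (hu : Function.Injective u)
    (hb : ∀ l m, u l < u m → b (u l) < b (u m)) (l m : Fin n) :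
    b (u l) < b (u m) ↔ u l < u m := by
  refine ⟨fun h => ?_, hb l m⟩
  have hne : l ≠ m := by rintro rfl; exact lt_irrefl _ h
  exact lt_of_le_of_ne (not_lt.1 fun h' => lt_asymm h (hb m l h')) (hu.ne hne)

lemma injective_comp_of_lt {b : ℝ → ℝ} {u : Fin n → ℝ} (hu : Function.Injective u)
    (hb : ∀ l m, u l < u m → b (u l) < b (u m)) : Function.Injective fun j => b (u j) := by
  intro l m h
  by_contra hne
  rcases lt_or_gt_of_ne (hu.ne hne) with h' | h'
  · exact (hb l m h').ne h
  · exact (hb m l h').ne' h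

/-- With bids in the same strict order as the values, an agent takes its truthful position. -/
lemma IsEfficientRule.position_bidProfile {g : AllocationRule n} (hg : IsEfficientRule g)
    {b : ℝ → ℝ} {i : Fin n} {v : ℝ} {w : Fin n → ℝ}
    (hu : Function.Injective (Function.update w i v))
    (hb : ∀ l m, Function.update w i v l < Function.update w i v m →
      b (Function.update w i v l) < b (Function.update w i v m)) :
    (g (bidProfile b i (b v) w) i : ℕ) = rivalsAbove i w v := by
  rw [bidProfile_apply_eq, hg.position_eq _ i fun m hm => (injective_comp_of_lt hu hb).ne hm,
    rivalsAbove_comp (lt_iff_lt_of_injective hu hb), Function.update_self, rivalsAbove_update]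

lemma vcg_pay_bidProfile {g : AllocationRule n} (hg : IsEfficientRule g) (hkn : k < n)
    (γ : Fin k → ℝ) {b : ℝ → ℝ} {i : Fin n} {v : ℝ} {w : Fin n → ℝ}
    (hu : Function.Injective (Function.update w i v))
    (hb : ∀ l m, Function.update w i v l < Function.update w i v m →
      b (Function.update w i v l) < b (Function.update w i v m)) :
    (vcg g γ).pay (bidProfile b i (b v) w) i = rivalSum γ b i v w := by
  rw [bidProfile_apply_eq, vcg_pay_eq hg hkn γ _ (injective_comp_of_lt hu hb),
    rivalSum_comp (lt_iff_lt_of_injective hu hb), Function.update_self, rivalSum_update]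

lemma div_lt_div_of_pivot {T₁ T₂ A₁ A₂ c : ℝ} (hA₁ : 0 < A₁) (hA : A₁ < A₂) (h₁ : T₁ < c * A₁)
    (h₂ : c * (A₂ - A₁) ≤ T₂ - T₁) : T₁ / A₁ < T₂ / A₂ := by
  rw [div_lt_div_iff₀ hA₁ (hA₁.trans hA)]
  nlinarith [mul_lt_mul_of_pos_right h₁ (sub_pos.2 hA), mul_le_mul_of_nonneg_right h₂ hA₁.le]

/-- Strict monotonicity extends from a dense set by continuity. -/
lemma strictMonoOn_of_dense {f : ℝ → ℝ} {a c : ℝ} (hf : ContinuousOn f (Set.Ioc a c)) {G : Set ℝ}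
    (hG : ∀ x y, a ≤ x → x < y → y ≤ c → (Set.Ioo x y ∩ G).Nonempty)
    (hmono : StrictMonoOn f (Set.Ioo a c ∩ G)) : StrictMonoOn f (Set.Ioc a c) := by
  intro x hx y hy hxy
  obtain ⟨p, hp, hpG⟩ := hG x y hx.1.le hxy hy.2
  obtain ⟨q, hq, hqG⟩ := hG p y (hx.1.trans hp.1).le hp.2 hy.2
  have hp' : p ∈ Set.Ioo a c ∩ G := ⟨⟨hx.1.trans hp.1, hp.2.trans_le hy.2⟩, hpG⟩
  have hq' : q ∈ Set.Ioo a c ∩ G := ⟨⟨hp'.1.1.trans hq.1, hq.2.trans_le hy.2⟩, hqG⟩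
  have h1 : f x ≤ f p := by
    by_contra! h
    have hU := (hf x hx).eventually (lt_mem_nhds h)
    rw [eventually_nhdsWithin_iff, Metric.eventually_nhds_iff] at hU
    obtain ⟨ε, hε, hU⟩ := hU
    obtain ⟨r, hr, hrG⟩ := hG x (min p (x + ε)) hx.1.le (lt_min hp.1 (by linarith))
      ((min_le_left _ _).trans hp'.1.2.le)
    have hr1 := hr.2.trans_le (min_le_left _ _)
    have hr2 := hr.2.trans_le (min_le_right _ _)
    have hrI : r ∈ Set.Ioo a c := ⟨hx.1.trans hr.1, hr1.trans hp'.1.2⟩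
    have h2 := hU (y := r) (by rw [Real.dist_eq, abs_lt]; constructor <;> linarith [hr.1])
      ⟨hrI.1, hrI.2.le⟩
    exact lt_asymm h2 (hmono ⟨hrI, hrG⟩ hp' hr1)
  have h2 : f q ≤ f y := by
    by_contra! h
    have hU := (hf y hy).eventually (gt_mem_nhds h)
    rw [eventually_nhdsWithin_iff, Metric.eventually_nhds_iff] at hU
    obtain ⟨ε, hε, hU⟩ := hU
    obtain ⟨r, hr, hrG⟩ := hG (max q (y - ε)) y (hq'.1.1.le.trans (le_max_left _ _))
      (max_lt hq.2 (by linarith)) hy.2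
    have hr1 := (le_max_left _ _).trans_lt hr.1
    have hr2 := (le_max_right _ _).trans_lt hr.1
    have hrI : r ∈ Set.Ioo a c := ⟨hq'.1.1.trans hr1, hr.2.trans_le hy.2⟩
    have h2 := hU (y := r) (by rw [Real.dist_eq, abs_lt]; constructor <;> linarith [hr.2])
      ⟨hrI.1, hrI.2.le⟩
    exact lt_asymm h2 (hmono hq' ⟨hrI, hrG⟩ hr1)
  exact h1.trans_lt ((hmono hp' hq' hq.1).trans_le h2)

namespace IsValueDistribution

variable {μ : Measure ℝ} {vbar : ℝ}

lemma measure_singleton (hμ : IsValueDistribution μ vbar) (t : ℝ) : μ {t} = 0 :=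
  hμ.absolutelyContinuous Real.volume_singleton

lemma ae_mem_Ioo (hμ : IsValueDistribution μ vbar) : ∀ᵐ t ∂μ, t ∈ Set.Ioo 0 vbar := by
  have h1 : ∀ᵐ t ∂μ, t ∈ Set.Icc 0 vbar := by
    rw [← hμ.support_eq]
    exact Measure.support_mem_ae
  have hne : ∀ s : ℝ, ∀ᵐ t ∂μ, t ≠ s := fun s =>
    measure_eq_zero_iff_ae_notMem.1 (hμ.measure_singleton s)
  filter_upwards [h1, hne 0, hne vbar] with t ht h0 hv
  exact ⟨lt_of_le_of_ne ht.1 h0.symm, lt_of_le_of_ne ht.2 hv⟩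

lemma measure_Ioo_pos (hμ : IsValueDistribution μ vbar) {x y : ℝ} (hx : 0 ≤ x) (hxy : x < y)
    (hy : y ≤ vbar) : 0 < μ (Set.Ioo x y) := by
  have hmem : (x + y) / 2 ∈ μ.support := by
    rw [hμ.support_eq]
    constructor <;> linarith
  exact (Measure.mem_support_iff_forall _).1 hmem _
    (Ioo_mem_nhds (by linarith) (by linarith))

lemma measure_Iio_pos (hμ : IsValueDistribution μ vbar) {y : ℝ} (hy : 0 < y) :
    0 < μ (Set.Iio y) :=
  (hμ.measure_Ioo_pos le_rfl (lt_min hy hμ.vbar_pos) (min_le_right _ _)).trans_le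
    (measure_mono fun _ ht => ht.2.trans_le (min_le_left _ _))

lemma ae_abs_le (hμ : IsValueDistribution μ vbar) : ∀ᵐ t ∂μ, |id t| ≤ vbar := by
  filter_upwards [hμ.ae_mem_Ioo] with t ht
  rw [id, abs_of_pos ht.1]
  exact ht.2.le

end IsValueDistribution

/-- The expected relative value of the position of agent `i`, when its value is `v`. -/
def expectedEntry {n : ℕ} (μ : Measure ℝ) (γ : Fin k → ℝ) (i : Fin n) (v : ℝ) : ℝ :=
  ∫ w, rivalSum γ 1 i v w ∂valueLaw n μ

/-- The expected payment of agent `i` with value `v` in the truthful VCG mechanism. -/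
def truthfulPayment {n : ℕ} (μ : Measure ℝ) (γ : Fin k → ℝ) (i : Fin n) (v : ℝ) : ℝ :=
  ∫ w, rivalSum γ id i v w ∂valueLaw n μ

/-- The first-price bid whose expected payment is the truthful one. -/
def firstPriceBid {n : ℕ} (μ : Measure ℝ) (α β : Fin k → ℝ) (i : Fin n) (v : ℝ) : ℝ :=
  truthfulPayment μ β i v / expectedEntry μ α i v

section Equilibrium

variable {μ : Measure ℝ} {vbar : ℝ} {α β γ : Fin k → ℝ}

lemma expectedEntry_lt (hμ : IsValueDistribution μ vbar) (hkn : k < n) (hγ : IsPositionVector γ)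
    (hk : 0 < k) (i : Fin n) {x y : ℝ} (hx : 0 ≤ x) (hxy : x < y) (hy : y ≤ vbar) :
    expectedEntry μ γ i x < expectedEntry μ γ i y := by
  have := hμ.isProbabilityMeasure
  have hi := integrable_rivalSum_one (μ := μ) γ i
  rw [← sub_pos, expectedEntry, expectedEntry, ← integral_sub (hi y) (hi x),
    integral_pos_iff_support_of_nonneg_ae (f := fun w => rivalSum γ 1 i y w - rivalSum γ 1 i x w) _
      ((hi y).sub (hi x))]
  · have hbox : 0 < valueLaw n μ (Set.univ.pi fun _ => Set.Ioo x y) := by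
      rw [valueLaw, Measure.pi_pi]
      exact pos_iff_ne_zero.2 (Finset.prod_ne_zero_iff.2
        fun _ _ => (hμ.measure_Ioo_pos hx hxy hy).ne')
    refine hbox.trans_le (measure_mono_ae ?_)
    filter_upwards [ae_injective_update hμ.measure_singleton i y] with w hinj hmem
    have hw : ∀ l, w l ∈ Set.Ioo x y := fun l => hmem l (Set.mem_univ l)
    have h1 : rivalSum γ 1 i x w = 0 :=
      Finset.sum_eq_zero fun l _ => if_neg (hw l).1.not_gt
    have h2 : 0 < rivalSum γ 1 i y w :=
      rivalSum_pos hkn hγ hk hinj (fun l _ => (hw l).2) fun _ _ => one_pos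
    exact (show 0 < rivalSum γ 1 i y w - rivalSum γ 1 i x w by rwa [h1, sub_zero]).ne'
  · refine Filter.Eventually.of_forall fun w => sub_nonneg.2 (rivalSum_le_rivalSum hγ ?_ ?_)
    · exact fun _ _ _ _ => zero_le_one
    · exact fun _ _ h h' => absurd (hxy.trans_le h) h'.not_gt

lemma rivalSum_zero_ae (hμ : IsValueDistribution μ vbar) (φ : ℝ → ℝ) (i : Fin n) :
    rivalSum γ φ i 0 =ᵐ[valueLaw n μ] 0 := by
  have := hμ.isProbabilityMeasure
  filter_upwards [ae_valueLaw_of_ae hμ.ae_mem_Ioo] with w hw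
  exact Finset.sum_eq_zero fun l _ => if_neg (hw l).1.not_gt

lemma expectedEntry_zero (hμ : IsValueDistribution μ vbar) (i : Fin n) :
    expectedEntry μ γ i 0 = 0 :=
  integral_eq_zero_of_ae (rivalSum_zero_ae hμ _ i)

lemma truthfulPayment_zero (hμ : IsValueDistribution μ vbar) (i : Fin n) :
    truthfulPayment μ γ i 0 = 0 :=
  integral_eq_zero_of_ae (rivalSum_zero_ae hμ _ i)

lemma expectedEntry_pos (hμ : IsValueDistribution μ vbar) (hkn : k < n) (hγ : IsPositionVector γ)
    (hk : 0 < k) (i : Fin n) {v : ℝ} (hv : 0 < v) : 0 < expectedEntry μ γ i v := by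
  have := hμ.isProbabilityMeasure
  exact integral_rivalSum_pos hμ.measure_singleton hkn hγ hk i (hμ.measure_Iio_pos hv)
    (integrable_rivalSum_one γ i v) (Filter.Eventually.of_forall fun _ _ _ _ => one_pos)

lemma integrable_rivalSum_id (hμ : IsValueDistribution μ vbar) (γ : Fin k → ℝ) (i : Fin n) (v : ℝ) :
    Integrable (rivalSum γ id i v) (valueLaw n μ) := by
  have := hμ.isProbabilityMeasure
  exact integrable_rivalSum γ measurable_id hμ.ae_abs_le i v

lemma truthfulPayment_pos (hμ : IsValueDistribution μ vbar) (hkn : k < n)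
    (hγ : IsPositionVector γ) (hk : 0 < k) (i : Fin n) {v : ℝ} (hv : 0 < v) :
    0 < truthfulPayment μ γ i v := by
  have := hμ.isProbabilityMeasure
  refine integral_rivalSum_pos hμ.measure_singleton hkn hγ hk i (hμ.measure_Iio_pos hv)
    (integrable_rivalSum_id hμ γ i v) ?_
  filter_upwards [ae_valueLaw_of_ae hμ.ae_mem_Ioo] with w hw l _ _ using (hw l).1

lemma continuous_expectedEntry (hμ : IsValueDistribution μ vbar) (γ : Fin k → ℝ) (i : Fin n) :
    Continuous (expectedEntry μ γ i) := by
  have := hμ.isProbabilityMeasure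
  exact continuous_integral_rivalSum hμ.measure_singleton γ measurable_one (C := 1) (by simp) i

lemma continuous_truthfulPayment (hμ : IsValueDistribution μ vbar) (γ : Fin k → ℝ) (i : Fin n) :
    Continuous (truthfulPayment μ γ i) := by
  have := hμ.isProbabilityMeasure
  exact continuous_integral_rivalSum hμ.measure_singleton γ measurable_id hμ.ae_abs_le i

lemma continuousOn_firstPriceBid (hμ : IsValueDistribution μ vbar) (hkn : k < n)
    (hα : IsPositionVector α) (hk : 0 < k) (i : Fin n) :
    ContinuousOn (firstPriceBid μ α β i) (Set.Ioc 0 vbar) :=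
  (continuous_truthfulPayment hμ β i).continuousOn.div (continuous_expectedEntry hμ α i).continuousOn
    fun _ hv => (expectedEntry_pos hμ hkn hα hk i hv.1).ne'

/-- At almost every value, the payment of an agent in an `α`-VCG equilibrium with the truthful
outcome is the `α`-weighted sum of the bids below. -/
lemma truthfulPayment_eq_of_yields (hμ : IsValueDistribution μ vbar) (hkn : k < n)
    {g : AllocationRule n} (hg : IsEfficientRule g) {b : ℝ → ℝ}
    (hb : IsBayesNash (vcg g α) β μ vbar b) (hy : YieldsTruthfulVCG (vcg g α) g β μ vbar b)
    (i : Fin n) {v : ℝ} (hv : v ∈ Set.Icc 0 vbar)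
    (hmono : ∀ᵐ w ∂valueLaw n μ, ∀ l m, Function.update w i v l < Function.update w i v m →
      b (Function.update w i v l) < b (Function.update w i v m)) :
    Integrable (rivalSum α b i v) (valueLaw n μ) ∧
      truthfulPayment μ β i v = ∫ w, rivalSum α b i v w ∂valueLaw n μ := by
  have := hμ.isProbabilityMeasure
  have hμ0 := hμ.measure_singleton
  have hpay : (fun w => (vcg g α).pay (bidProfile b i (b v) w) i) =ᵐ[valueLaw n μ]
      rivalSum α b i v := by
    filter_upwards [hmono, ae_injective_update hμ0 i v] with w hw hu
    exact vcg_pay_bidProfile hg hkn α hu hw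
  constructor
  · have h1 := (integrable_rivalSum_one (μ := μ) β i v).mul_const v
    refine (h1.sub (hb.integrable i v hv (b v))).congr ?_
    filter_upwards [hmono, ae_injective_update hμ0 i v, ae_entry_rivalsAbove_eq hμ0 hkn β i v, hpay]
      with w hw hu he hp
    have hpos : ((vcg g α).alloc (bidProfile b i (b v) w) i : ℕ) = rivalsAbove i w v :=
      hg.position_bidProfile hu hw
    simp only [Pi.sub_apply, utility]
    rw [hpos, he, hp]
    ring
  · have h := hy.pay_eq i v hv
    rw [expectedPayment_truthful hμ0 hg hkn] at h
    exact h.symm.trans (integral_congr_ae hpay)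

lemma firstPriceBid_zero (hμ : IsValueDistribution μ vbar) (i : Fin n) :
    firstPriceBid μ α β i 0 = 0 := by
  rw [firstPriceBid, truthfulPayment_zero hμ, zero_div]

lemma firstPriceBid_pos (hμ : IsValueDistribution μ vbar) (hkn : k < n)
    (hα : IsPositionVector α) (hβ : IsPositionVector β) (hk : 0 < k) (i : Fin n) {v : ℝ}
    (hv : 0 < v) : 0 < firstPriceBid μ α β i v :=
  div_pos (truthfulPayment_pos hμ hkn hβ hk i hv) (expectedEntry_pos hμ hkn hα hk i hv)

theorem strictMonoOn_firstPriceBid (hμ : IsValueDistribution μ vbar) (hkn : k < n)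
    (hα : IsPositionVector α) (hβ : IsPositionVector β) (hk : 0 < k)
    {g : AllocationRule n} (hg : IsEfficientRule g)
    (hV : ObtainsTruthfulVCG (vcg g α) g β μ vbar) (i : Fin n) :
    StrictMonoOn (firstPriceBid μ α β i) (Set.Icc 0 vbar) := by
  have := hμ.isProbabilityMeasure
  have hμ0 := hμ.measure_singleton
  obtain ⟨b, hb, hy⟩ := hV
  let P : ℝ → Prop := fun v => ∀ᵐ w ∂valueLaw n μ, ∀ l m,
    Function.update w i v l < Function.update w i v m →
      b (Function.update w i v l) < b (Function.update w i v m)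
  have hP : ∀ᵐ v ∂μ, P v :=
    ae_ae_update (ae_bid_lt_bid hμ0 (by omega) hg hb.measurable hy.alloc_eq) i
  have hbelow : ∀ v, P v → ∀ᵐ w ∂valueLaw n μ, ∀ l, l ≠ i → w l < v → b (w l) < b v := by
    intro v hv
    filter_upwards [hv] with w hw l hl h
    simpa [Function.update_of_ne hl, h] using hw l i
  have habove : ∀ v, P v → ∀ᵐ w ∂valueLaw n μ, ∀ l, l ≠ i → v < w l → b v < b (w l) := by
    intro v hv
    filter_upwards [hv] with w hw l hl h
    simpa [Function.update_of_ne hl, h] using hw i l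
  have hIoc : StrictMonoOn (firstPriceBid μ α β i) (Set.Ioc 0 vbar) := by
    refine strictMonoOn_of_dense (continuousOn_firstPriceBid hμ hkn hα hk i) (G := {v | P v})
      (fun x y hx hxy hyv => ?_) ?_
    · by_contra hempty
      refine (hμ.measure_Ioo_pos hx hxy hyv).ne' (measure_eq_zero_iff_ae_notMem.2 ?_)
      filter_upwards [hP] with t hPt ht using hempty ⟨t, ht, hPt⟩
    · rintro x ⟨hx, hPx⟩ y ⟨hy', hPy⟩ hxy
      obtain ⟨hix, hTx⟩ := truthfulPayment_eq_of_yields hμ hkn hg hb hy i ⟨hx.1.le, hx.2.le⟩ hPx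
      obtain ⟨hiy, hTy⟩ := truthfulPayment_eq_of_yields hμ hkn hg hb hy i ⟨hy'.1.le, hy'.2.le⟩ hPy
      have hEx := (integrable_rivalSum_one (μ := μ) α i x).const_mul (b x)
      have hEy := (integrable_rivalSum_one (μ := μ) α i y).const_mul (b x)
      have hsubx : Integrable (rivalSum α (fun t => b x - b t) i x) (valueLaw n μ) :=
        (hEx.sub hix).congr (Filter.Eventually.of_forall fun w =>
          (rivalSum_const_sub α b (b x) i x w).symm)
      have hsuby : Integrable (rivalSum α (fun t => b x - b t) i y) (valueLaw n μ) :=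
        (hEy.sub hiy).congr (Filter.Eventually.of_forall fun w =>
          (rivalSum_const_sub α b (b x) i y w).symm)
      have hvx : ∫ w, rivalSum α (fun t => b x - b t) i x w ∂valueLaw n μ =
          b x * expectedEntry μ α i x - truthfulPayment μ β i x := by
        simp only [rivalSum_const_sub]
        rw [integral_sub hEx hix, integral_const_mul, hTx, expectedEntry]
      have hvy : ∫ w, rivalSum α (fun t => b x - b t) i y w ∂valueLaw n μ =
          b x * expectedEntry μ α i y - truthfulPayment μ β i y := by
        simp only [rivalSum_const_sub]
        rw [integral_sub hEy hiy, integral_const_mul, hTy, expectedEntry]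
      refine div_lt_div_of_pivot (c := b x) (expectedEntry_pos hμ hkn hα hk i hx.1)
        (expectedEntry_lt hμ hkn hα hk i hx.1.le hxy hy'.2.le) ?_ ?_
      · rw [← sub_pos, ← hvx]
        refine integral_rivalSum_pos hμ0 hkn hα hk i (hμ.measure_Iio_pos hx.1) hsubx ?_
        filter_upwards [hbelow x hPx] with w hw l hl h using sub_pos.2 (hw l hl h)
      · suffices h : ∫ w, rivalSum α (fun t => b x - b t) i y w ∂valueLaw n μ ≤
            ∫ w, rivalSum α (fun t => b x - b t) i x w ∂valueLaw n μ by
          rw [hvx, hvy] at h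
          linarith
        refine integral_mono_ae hsuby hsubx ?_
        have hne : ∀ᵐ t ∂μ, t ≠ x := measure_eq_zero_iff_ae_notMem.1 (hμ0 x)
        filter_upwards [habove x hPx, ae_valueLaw_of_ae hne] with w hw hnew
        refine rivalSum_le_rivalSum hα (fun l _ h h' => ?_) fun l hl h _ => ?_
        · exact absurd (h'.trans hxy) h.not_gt
        · exact (sub_neg.2 (hw l hl (lt_of_le_of_ne h (hnew l).symm))).le
  intro x hx y hy' hxy
  rcases hx.1.eq_or_lt with h0 | h0
  · subst h0
    rw [firstPriceBid_zero hμ]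
    exact firstPriceBid_pos hμ hkn hα hβ hk i hxy
  · exact hIoc ⟨h0, hx.2⟩ ⟨hx.1.trans_lt hxy, hy'.2⟩ hxy

lemma measurable_firstPriceBid (hμ : IsValueDistribution μ vbar) (i : Fin n) :
    Measurable (firstPriceBid μ α β i) :=
  (continuous_truthfulPayment hμ β i).measurable.div (continuous_expectedEntry hμ α i).measurable

lemma ae_position_gfp (hμ : IsValueDistribution μ vbar) {g : AllocationRule n}
    (hg : IsEfficientRule g) {B : ℝ → ℝ} (hB : StrictMonoOn B (Set.Icc 0 vbar)) (i : Fin n)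
    (x : ℝ) : ∀ᵐ w ∂valueLaw n μ,
      (g (bidProfile B i x w) i : ℕ) = rivalsAbove i (fun j => B (w j)) x := by
  have := hμ.isProbabilityMeasure
  have hne : ∀ᵐ t ∂μ, B t ≠ x := by
    by_cases h : ∃ s ∈ Set.Icc 0 vbar, B s = x
    · obtain ⟨s, hs, rfl⟩ := h
      have h1 : ∀ᵐ t ∂μ, t ≠ s := measure_eq_zero_iff_ae_notMem.1 (hμ.measure_singleton s)
      filter_upwards [h1, hμ.ae_mem_Ioo] with t ht hI heq
      exact ht (hB.injOn ⟨hI.1.le, hI.2.le⟩ hs heq)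
    · push Not at h
      filter_upwards [hμ.ae_mem_Ioo] with t hI using h t ⟨hI.1.le, hI.2.le⟩
  filter_upwards [ae_valueLaw_of_ae hne] with w hw
  rw [hg.position_eq _ i fun m hm => by simpa [bidProfile, Function.update_of_ne hm] using hw m]
  simp only [bidProfile, Function.update_self, rivalsAbove_update]

lemma integrable_utility_gfp (hμ : IsValueDistribution μ vbar) {g : AllocationRule n}
    (hg : IsEfficientRule g) {B : ℝ → ℝ} (hBm : Measurable B)
    (hB : StrictMonoOn B (Set.Icc 0 vbar)) (i : Fin n) (v x : ℝ) :
    Integrable (fun w => utility (gfp g α) β i (bidProfile B i x w) v) (valueLaw n μ) := by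
  have := hμ.isProbabilityMeasure
  have hBw : Measurable fun (w : Fin n → ℝ) j => B (w j) :=
    measurable_pi_iff.2 fun j => hBm.comp (measurable_pi_apply j)
  have hr : Measurable fun w : Fin n → ℝ => rivalsAbove i (fun j => B (w j)) x :=
    (measurable_rivalsAbove i measurable_const).comp hBw
  have h1 : Measurable fun j : ℕ => entry β j * v - entry α j * x := measurable_from_top
  have hint : Integrable (fun w : Fin n → ℝ =>
      entry β (rivalsAbove i (fun j => B (w j)) x) * v -
        entry α (rivalsAbove i (fun j => B (w j)) x) * x) (valueLaw n μ) := by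
    refine Integrable.of_bound (h1.comp hr).aestronglyMeasurable
      ((∑ j, |β j|) * |v| + (∑ j, |α j|) * |x|) (Filter.Eventually.of_forall fun w => ?_)
    refine (norm_sub_le _ _).trans (add_le_add ?_ ?_)
    · rw [norm_mul, Real.norm_eq_abs, Real.norm_eq_abs]
      exact mul_le_mul_of_nonneg_right (abs_entry_le β _) (abs_nonneg v)
    · rw [norm_mul, Real.norm_eq_abs, Real.norm_eq_abs]
      exact mul_le_mul_of_nonneg_right (abs_entry_le α _) (abs_nonneg x)
  refine hint.congr ?_
  filter_upwards [ae_position_gfp hμ hg hB i x] with w hw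
  simp only [utility, gfp, hw, bidProfile_self]

/-- Bidding like type `u` gives the position of type `u`. -/
lemma ae_entry_gfp (hμ : IsValueDistribution μ vbar) (hkn : k < n) {g : AllocationRule n}
    (hg : IsEfficientRule g) {B : ℝ → ℝ} (hB : StrictMonoOn B (Set.Icc 0 vbar)) (i : Fin n)
    {u : ℝ} (hu : u ∈ Set.Icc 0 vbar) (γ : Fin k → ℝ) :
    ∀ᵐ w ∂valueLaw n μ, entry γ (g (bidProfile B i (B u) w) i) = rivalSum γ 1 i u w := by
  have := hμ.isProbabilityMeasure
  filter_upwards [ae_position_gfp hμ hg hB i (B u), ae_valueLaw_of_ae hμ.ae_mem_Ioo,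
    ae_entry_rivalsAbove_eq hμ.measure_singleton hkn γ i u] with w hw hI he
  have : rivalsAbove i (fun j => B (w j)) (B u) = rivalsAbove i w u := by
    simp only [rivalsAbove, fun m => hB.lt_iff_lt hu ⟨(hI m).1.le, (hI m).2.le⟩]
  rw [hw, this, he]

lemma expectedEntry_mul_firstPriceBid (hμ : IsValueDistribution μ vbar) (hkn : k < n)
    (hα : IsPositionVector α) (hk : 0 < k) (i i₀ : Fin n) {u : ℝ} (hu : 0 ≤ u) :
    expectedEntry μ α i u * firstPriceBid μ α β i₀ u = truthfulPayment μ β i u := by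
  have := hμ.isProbabilityMeasure
  have hA : expectedEntry μ α i u = expectedEntry μ α i₀ u :=
    integral_rivalSum_eq α measurable_one i i₀ u
  have hT : truthfulPayment μ β i u = truthfulPayment μ β i₀ u :=
    integral_rivalSum_eq β measurable_id i i₀ u
  rw [hA, hT]
  rcases hu.eq_or_lt with rfl | h
  · rw [expectedEntry_zero hμ, truthfulPayment_zero hμ, zero_mul]
  · exact mul_div_cancel₀ _ (expectedEntry_pos hμ hkn hα hk i₀ h).ne'

lemma expectedUtility_gfp_eq (hμ : IsValueDistribution μ vbar) (hkn : k < n)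
    (hα : IsPositionVector α) (hk : 0 < k) {g : AllocationRule n} (hg : IsEfficientRule g)
    {i₀ : Fin n} (hB : StrictMonoOn (firstPriceBid μ α β i₀) (Set.Icc 0 vbar)) (i : Fin n)
    {u : ℝ} (hu : u ∈ Set.Icc 0 vbar) (v : ℝ) :
    expectedUtility (gfp g α) β μ (firstPriceBid μ α β i₀) i (firstPriceBid μ α β i₀ u) v =
      ∫ w, rivalSum β (fun t => v - id t) i u w ∂valueLaw n μ := by
  have := hμ.isProbabilityMeasure
  have h1 : expectedUtility (gfp g α) β μ (firstPriceBid μ α β i₀) i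
      (firstPriceBid μ α β i₀ u) v = ∫ w, (v * rivalSum β 1 i u w -
        rivalSum α 1 i u w * firstPriceBid μ α β i₀ u) ∂valueLaw n μ := by
    refine integral_congr_ae ?_
    filter_upwards [ae_entry_gfp hμ hkn hg hB i hu α, ae_entry_gfp hμ hkn hg hB i hu β]
      with w h2 h3
    simp only [utility, gfp, h2, h3]
    rw [bidProfile_self, mul_comm v]
  simp only [rivalSum_const_sub]
  rw [h1, integral_sub ((integrable_rivalSum_one β i u).const_mul v)
    ((integrable_rivalSum_one α i u).mul_const _), integral_mul_const,
    integral_sub ((integrable_rivalSum_one β i u).const_mul v) (integrable_rivalSum_id hμ β i u)]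
  congr 1
  exact expectedEntry_mul_firstPriceBid hμ hkn hα hk i i₀ hu.1

lemma integral_rivalSum_sub_le (hμ : IsValueDistribution μ vbar) (hβ : IsPositionVector β)
    (i : Fin n) (u v : ℝ) :
    ∫ w, rivalSum β (fun t => v - id t) i u w ∂valueLaw n μ ≤
      ∫ w, rivalSum β (fun t => v - id t) i v w ∂valueLaw n μ := by
  have := hμ.isProbabilityMeasure
  have hint : ∀ u, Integrable (rivalSum β (fun t => v - id t) i u) (valueLaw n μ) := fun u =>
    (((integrable_rivalSum_one (μ := μ) β i u).const_mul v).sub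
      (integrable_rivalSum_id hμ β i u)).congr (Filter.Eventually.of_forall fun w =>
        (rivalSum_const_sub β id v i u w).symm)
  refine integral_mono (hint u) (hint v) fun w => rivalSum_le_rivalSum hβ ?_ ?_
  · exact fun l _ _ h => sub_nonneg.2 h.le
  · exact fun l _ h _ => sub_nonpos.2 h

theorem isBayesNash_gfp (hμ : IsValueDistribution μ vbar) (hkn : k < n)
    (hα : IsPositionVector α) (hβ : IsPositionVector β) (hk : 0 < k) {g : AllocationRule n}
    (hg : IsEfficientRule g) {i₀ : Fin n}
    (hB : StrictMonoOn (firstPriceBid μ α β i₀) (Set.Icc 0 vbar)) :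
    IsBayesNash (gfp g α) β μ vbar (firstPriceBid μ α β i₀) := by
  have := hμ.isProbabilityMeasure
  have hBm : Measurable (firstPriceBid μ α β i₀) := measurable_firstPriceBid hμ i₀
  have hvb : vbar ∈ Set.Icc 0 vbar := ⟨hμ.vbar_pos.le, le_rfl⟩
  refine ⟨hBm, fun i v _ x => integrable_utility_gfp hμ hg hBm hB i v x, fun i v hv x => ?_⟩
  have hlike : ∀ u ∈ Set.Icc 0 vbar,
      expectedUtility (gfp g α) β μ (firstPriceBid μ α β i₀) i (firstPriceBid μ α β i₀ u) v ≤
      expectedUtility (gfp g α) β μ (firstPriceBid μ α β i₀) i (firstPriceBid μ α β i₀ v) v := by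
    intro u hu
    rw [expectedUtility_gfp_eq hμ hkn hα hk hg hB i hu,
      expectedUtility_gfp_eq hμ hkn hα hk hg hB i hv]
    exact integral_rivalSum_sub_le hμ hβ i u v
  rcases lt_or_ge (firstPriceBid μ α β i₀ vbar) x with hx | hx
  · refine le_trans (integral_mono_ae (integrable_utility_gfp hμ hg hBm hB i v x)
      (integrable_utility_gfp hμ hg hBm hB i v (firstPriceBid μ α β i₀ vbar)) ?_) (hlike vbar hvb)
    filter_upwards [ae_position_gfp hμ hg hB i x,
      ae_position_gfp hμ hg hB i (firstPriceBid μ α β i₀ vbar),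
      ae_valueLaw_of_ae hμ.ae_mem_Ioo] with w h1 h2 hI
    have hr : ∀ y, firstPriceBid μ α β i₀ vbar ≤ y →
        rivalsAbove i (fun j => firstPriceBid μ α β i₀ (w j)) y = 0 := fun y hy =>
      Finset.card_eq_zero.2 (Finset.filter_eq_empty_iff.2 fun m _ =>
        ((hB ⟨(hI m).1.le, (hI m).2.le⟩ hvb (hI m).2).trans_le hy).not_gt)
    rw [hr x hx.le] at h1
    rw [hr _ le_rfl] at h2
    simp only [utility, gfp, h1, h2, bidProfile_self]
    exact sub_le_sub_left (mul_le_mul_of_nonneg_left hx.le (entry_nonneg hα 0)) _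
  · by_cases hex : ∃ u ∈ Set.Ioc 0 vbar, firstPriceBid μ α β i₀ u ≤ x
    · obtain ⟨u, hu, hux⟩ := hex
      have hsub : Set.Icc u vbar ⊆ Set.Ioc 0 vbar := fun t ht => ⟨hu.1.trans_le ht.1, ht.2⟩
      obtain ⟨t, ht, rfl⟩ := intermediate_value_Icc hu.2
        ((continuousOn_firstPriceBid (β := β) hμ hkn hα hk i₀).mono hsub) ⟨hux, hx⟩
      exact hlike t ⟨(hsub ht).1.le, (hsub ht).2⟩
    · push Not at hex
      have hzero : expectedUtility (gfp g α) β μ (firstPriceBid μ α β i₀) i x v = 0 := by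
        refine integral_eq_zero_of_ae ?_
        filter_upwards [ae_position_gfp hμ hg hB i x, ae_valueLaw_of_ae hμ.ae_mem_Ioo] with w h1 hI
        have hr : rivalsAbove i (fun j => firstPriceBid μ α β i₀ (w j)) x = n - 1 := by
          rw [rivalsAbove, Finset.filter_true_of_mem fun m _ => hex _ ⟨(hI m).1, (hI m).2.le⟩,
            Finset.card_erase_of_mem (Finset.mem_univ i), Finset.card_univ, Fintype.card_fin]
        rw [hr] at h1
        simp [utility, gfp, h1, entry_eq_zero _ (show k ≤ n - 1 by omega)]
      rw [hzero, expectedUtility_gfp_eq hμ hkn hα hk hg hB i hv]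
      exact integral_nonneg fun w => rivalSum_nonneg hβ fun l _ h => sub_nonneg.2 h.le

theorem yieldsTruthfulVCG_gfp (hμ : IsValueDistribution μ vbar) (hkn : k < n)
    (hα : IsPositionVector α) (hk : 0 < k) {g : AllocationRule n}
    (hg : IsEfficientRule g) {i₀ : Fin n}
    (hB : StrictMonoOn (firstPriceBid μ α β i₀) (Set.Icc 0 vbar)) :
    YieldsTruthfulVCG (gfp g α) g β μ vbar (firstPriceBid μ α β i₀) := by
  have := hμ.isProbabilityMeasure
  refine ⟨?_, fun i v hv => ?_⟩
  · filter_upwards [ae_valueLaw_of_ae hμ.ae_mem_Ioo,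
      ae_injective_comp (n := n) measurable_id fun c => hμ.measure_singleton c] with w hI hinj
    replace hinj : Function.Injective w := hinj
    have hmono : ∀ l m, w l < w m → firstPriceBid μ α β i₀ (w l) < firstPriceBid μ α β i₀ (w m) :=
      fun l m h => hB ⟨(hI l).1.le, (hI l).2.le⟩ ⟨(hI m).1.le, (hI m).2.le⟩ h
    refine Equiv.ext fun i => Fin.ext ?_
    change (g _ i : ℕ) = g w i
    rw [hg.position_eq _ i fun m hm => (injective_comp_of_lt hinj hmono).ne hm,
      hg.position_eq w i fun m hm => hinj.ne hm,
      rivalsAbove_comp (lt_iff_lt_of_injective hinj hmono)]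
  · rw [expectedPayment_truthful hμ.measure_singleton hg hkn]
    refine Eq.trans ?_ (expectedEntry_mul_firstPriceBid hμ hkn hα hk i i₀ hv.1)
    rw [expectedEntry, ← integral_mul_const]
    refine integral_congr_ae ?_
    filter_upwards [ae_entry_gfp hμ hkn hg hB i hv α] with w h
    simp only [gfp, h, bidProfile_self]

end Equilibrium

end PositionAuction

end

theorem theorem2 (n k : ℕ) (hkn : k < n) (α β : Fin k → ℝ)
    (hα : PositionAuction.IsPositionVector α) (hβ : PositionAuction.IsPositionVector β)
    (μ : MeasureTheory.Measure ℝ) (vbar : ℝ) (hμ : PositionAuction.IsValueDistribution μ vbar)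
    (g : PositionAuction.AllocationRule n) (hg : PositionAuction.IsEfficientRule g)
    (hV : PositionAuction.ObtainsTruthfulVCG (PositionAuction.vcg g α) g β μ vbar) :
    PositionAuction.ObtainsTruthfulVCG (PositionAuction.gfp g α) g β μ vbar := by
  rcases Nat.eq_zero_or_pos k with rfl | hk
  · have hzero : ∀ (γ : Fin 0 → ℝ) (j : ℕ), PositionAuction.entry γ j = 0 := fun γ j =>
      PositionAuction.entry_eq_zero γ (Nat.zero_le j)
    refine ⟨id, ⟨measurable_id, fun i v _ x => ?_, fun i v _ x => ?_⟩,
      ⟨Filter.Eventually.of_forall fun w => rfl, fun i v _ => ?_⟩⟩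
    · simp [PositionAuction.utility, PositionAuction.gfp, hzero]
    · simp [PositionAuction.expectedUtility, PositionAuction.utility, PositionAuction.gfp, hzero]
    · simp [PositionAuction.expectedPayment, PositionAuction.vcg, PositionAuction.gfp, hzero]
  · have hB := PositionAuction.strictMonoOn_firstPriceBid hμ hkn hα hβ hk hg hV ⟨0, by omega⟩
    exact ⟨_, PositionAuction.isBayesNash_gfp hμ hkn hα hβ hk hg hB,
      PositionAuction.yieldsTruthfulVCG_gfp hμ hkn hα hk hg hB⟩
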